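/- Let $H$ be a complex Hilbert space and let $M\subset B(H)$ be a finite factor with its faithful normal tracial state $\tau$. Let $\alpha$ be an involutive $*$-antiautomorphism of $M$, i.e. a complex linear map $\alpha:M\to M$ with $\alpha(x^*)=\alpha(x)^*$, $\alpha(xy)=\alpha(y)\alpha(x)$ and $\alpha^2(x)=x$, and put $(M,\alpha)=\{x\in M:\alpha(x)=x^*\}$. Let $L^2(M)$ be the completion of $M$ in the norm $\|x\|_2=\tau(x^*x)^{1/2}$, let $L^2(M,\alpha)\subset L^2(M)$ be the real Hilbert space which is the completion of $(M,\alpha)$, and let $\lambda(x)\in B(L^2(M))$ be the extension of $y\mapsto xy$, $x,y\in M$. For $x\in(M,\alpha)$ let $\lambda_r(x)$ be the bounded operator on $L^2(M,\alpha)$ extending $y\mapsto xy$, $y\in(M,\alpha)$. Let $\lambda_r(M,\alpha)=\{\lambda_r(x):x\in(M,\alpha)\}$, regarded as a set of operators on $L^2(M)$ by identifying an operator on $L^2(M,\alpha)$ with its complex linear extension to $L^2(M)=L^2(M,\alpha)+iL^2(M,\alpha)$. Let $J$ be the conjugate linear isometry of $L^2(M)$ extending $x\mapsto x^*$, let $\lambda(M)'$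 be the commutant of $\lambda(M)$ in $B(L^2(M))$, and let $\beta:\lambda(M)\to\lambda(M)$ be given by $\beta(\lambda(x))=\lambda(\alpha(x))$. Then $JTJ\in\lambda(M)$ for every $T\in\lambda(M)'$, so that $\beta'(T)=J\,\beta(JTJ)\,J$ defines a map $\beta':\lambda(M)'\to\lambda(M)'$, and the real commutant algebra $$\lambda_r(M,\alpha)'=\{T\in\lambda(M)':\ \beta'(T)=T^*\}$$ satisfies $$\lambda_r(M,\alpha)'=J\,\lambda_r(M,\alpha)\,J=\{JSJ:\ S\in\lambda_r(M,\alpha)\}.$$ -/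

import Mathlib

open scoped ComplexOrder InnerProductSpace

/-! ### Von Neumann algebras -/

namespace VonNeumannAlgebra

variable {H : Type*} [NormedAddCommGroup H] [InnerProductSpace ℂ H] [CompleteSpace H]

/-- A von Neumann algebra is norm closed, hence a C⋆-algebra. -/
instance instIsClosedCoe (M : VonNeumannAlgebra H) : IsClosed (M : Set (H →L[ℂ] H)) := by
  rw [← M.centralizer_centralizer]
  exact Set.isClosed_centralizer _

instance instSMulMemClass : SMulMemClass (VonNeumannAlgebra H) ℂ (H →L[ℂ] H) where
  smul_mem {M} c _ hx := M.toStarSubalgebra.smul_mem hx c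

/-- The order on `M` inherited from the (Loewner) order of operators is the order of the
C⋆-algebra `M`. -/
instance instStarOrderedRingCoe (M : VonNeumannAlgebra H) : StarOrderedRing M := by
  refine StarOrderedRing.of_nonneg_iff' (fun {x y} hxy z => ?_) (fun x => ⟨fun hx => ?_, ?_⟩)
  · have h : (x : H →L[ℂ] H) ≤ y := hxy
    have h' : (z : H →L[ℂ] H) + x ≤ z + y := by gcongr
    exact h'
  · have hx' : 0 ≤ (x : H →L[ℂ] H) := hx
    have hmem : CFC.sqrt (x : H →L[ℂ] H) ∈ M := by
      rw [← SetLike.mem_coe, ← M.centralizer_centralizer]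
      intro y hy
      have hc : Commute (x : H →L[ℂ] H) y := hy x x.2
      exact (hc.cfcₙ_nnreal NNReal.sqrt).eq.symm
    refine ⟨⟨CFC.sqrt (x : H →L[ℂ] H), hmem⟩, Subtype.ext ?_⟩
    change (x : H →L[ℂ] H) = star (CFC.sqrt (x : H →L[ℂ] H)) * CFC.sqrt (x : H →L[ℂ] H)
    rw [(CFC.sqrt_nonneg (x : H →L[ℂ] H)).star_eq, CFC.sqrt_mul_sqrt_self _ hx']
  · rintro ⟨s, rfl⟩
    exact star_mul_self_nonneg (s : H →L[ℂ] H)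

/-- `M` is a factor: its center consists of the scalar operators. -/
def IsFactor (M : VonNeumannAlgebra H) : Prop :=
  ∀ z ∈ M, z ∈ M.commutant → ∃ c : ℂ, z = c • (1 : H →L[ℂ] H)

/-- `M` is finite: every isometry in `M` is unitary. -/
def IsFinite (M : VonNeumannAlgebra H) : Prop :=
  ∀ v ∈ M, star v * v = 1 → v * star v = 1

/-- A functional on `M` is normal if it is ultraweakly continuous, that is, of the form
`x ↦ ∑ₙ ⟪ξₙ, x ηₙ⟫` with `∑ₙ ‖ξₙ‖² < ∞` and `∑ₙ ‖ηₙ‖² < ∞`. -/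
def IsNormalFunctional (M : VonNeumannAlgebra H) (φ : M → ℂ) : Prop :=
  ∃ ξ η : ℕ → H, Summable (fun n => ‖ξ n‖ ^ 2) ∧ Summable (fun n => ‖η n‖ ^ 2) ∧
    ∀ x : M, HasSum (fun n => ⟪ξ n, (x : H →L[ℂ] H) (η n)⟫_ℂ) (φ x)

end VonNeumannAlgebra

/-- A faithful tracial state on a C⋆-algebra. -/
structure IsFaithfulTracialState {A : Type*} [CStarAlgebra A] [PartialOrder A]
    (τ : A →ₚ[ℂ] ℂ) : Prop where
  map_one : τ 1 = 1
  map_mul_comm : ∀ x y : A, τ (x * y) = τ (y * x)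
  faithful : ∀ x : A, τ (star x * x) = 0 → x = 0

/-- An involutive *-antiautomorphism: a complex linear, *-preserving, antimultiplicative map
which is its own inverse. -/
structure InvolutiveStarAntiaut (A : Type*) [CStarAlgebra A] extends A →ₗ[ℂ] A where
  map_star' : ∀ x, toFun (star x) = star (toFun x)
  map_mul' : ∀ x y, toFun (x * y) = toFun y * toFun x
  involutive' : ∀ x, toFun (toFun x) = x

namespace InvolutiveStarAntiaut

variable {A : Type*} [CStarAlgebra A]

instance : CoeFun (InvolutiveStarAntiaut A) (fun _ => A → A) := ⟨fun α => α.toFun⟩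

/-- The real algebra `(A, α) = {x ∈ A : α(x) = x*}`. -/
def realForm (α : InvolutiveStarAntiaut A) : StarSubalgebra ℝ A where
  carrier := {x | α x = star x}
  mul_mem' {x y} hx hy := by
    simp only [Set.mem_ofPred_eq] at *
    rw [α.map_mul', hx, hy, star_mul]
  add_mem' {x y} hx hy := by
    simp only [Set.mem_ofPred_eq] at *
    rw [star_add, ← hx, ← hy]
    exact map_add α.toLinearMap x y
  algebraMap_mem' r := by
    have h1 : α 1 = 1 := by
      have h := α.map_mul' (α 1) 1
      rw [mul_one, α.involutive', mul_one] at h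
      exact h.symm
    have h2 : α ((r : ℂ) • (1 : A)) = (r : ℂ) • α 1 := map_smul α.toLinearMap _ _
    have h3 : algebraMap ℝ A r = (r : ℂ) • (1 : A) := by
      rw [Algebra.algebraMap_eq_smul_one, Complex.coe_smul]
    simp only [Set.mem_ofPred_eq]
    rw [h3, h2, h1, star_smul, star_one]
    simp
  star_mem' {x} hx := by
    simp only [Set.mem_ofPred_eq] at *
    rw [α.map_star', hx]

end InvolutiveStarAntiaut

/-! ### The canonical representation on `L²`

For a faithful tracial state `τ` on `A`, the Hilbert space `L²(A)` is `τ.GNS`, the completion of `A`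
for the inner product `⟨x, y⟩ = τ(x* y)`, and `λ(x)`, the extension of `y ↦ x y`, is
`τ.gnsStarAlgHom x`. -/

namespace CanonicalRep

variable {A : Type*} [CStarAlgebra A] [PartialOrder A] [StarOrderedRing A]

/-- The canonical map from `A` to `L²(A)`. -/
noncomputable def toL2 (τ : A →ₚ[ℂ] ℂ) : A →ₗ[ℂ] τ.GNS where
  toFun x := (τ.toPreGNS x : τ.GNS)
  map_add' x y := by simp [UniformSpace.Completion.coe_add]
  map_smul' c x := by simp [UniformSpace.Completion.coe_smul]

theorem denseRange_toL2 (τ : A →ₚ[ℂ] ℂ) : DenseRange (toL2 τ) :=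
  UniformSpace.Completion.denseRange_coe (α := τ.PreGNS)

theorem gns_toL2 (τ : A →ₚ[ℂ] ℂ) (x y : A) :
    τ.gnsStarAlgHom x (toL2 τ y) = toL2 τ (x * y) := by
  change τ.gnsNonUnitalStarAlgHom x (τ.toPreGNS y : τ.GNS) = (τ.toPreGNS (x * y) : τ.GNS)
  simp

/-- The algebra `λ(A)` of operators on `L²(A)`. -/
noncomputable def lam (τ : A →ₚ[ℂ] ℂ) : StarSubalgebra ℂ (τ.GNS →L[ℂ] τ.GNS) :=
  τ.gnsStarAlgHom.range

/-- The commutant `λ(A)'`. -/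
def lamCommutant (τ : A →ₚ[ℂ] ℂ) : Set (τ.GNS →L[ℂ] τ.GNS) :=
  Set.centralizer (lam τ : Set (τ.GNS →L[ℂ] τ.GNS))

theorem gns_injective {τ : A →ₚ[ℂ] ℂ} (hτ : IsFaithfulTracialState τ) :
    Function.Injective τ.gnsStarAlgHom := by
  rw [injective_iff_map_eq_zero]
  intro x hx
  have h1 : toL2 τ x = 0 := by
    have h := gns_toL2 τ x 1
    rw [hx, mul_one] at h
    exact h.symm
  have h2 : ‖τ.toPreGNS x‖ = 0 := by
    rw [← UniformSpace.Completion.norm_coe]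
    exact norm_eq_zero.mpr h1
  have h3 := τ.preGNS_norm_sq (τ.toPreGNS x)
  rw [h2] at h3
  exact hτ.faithful x (by simpa using h3.symm)

/-- The conjugate linear operator `J` on `L²(A)` which extends `x ↦ x*`. -/
noncomputable def J {τ : A →ₚ[ℂ] ℂ} (hτ : IsFaithfulTracialState τ) : τ.GNS →L⋆[ℂ] τ.GNS :=
  ContinuousLinearMap.completion
    (LinearMap.mkContinuous
      (σ := starRingEnd ℂ) (E := τ.PreGNS) (F := τ.PreGNS)
      { toFun := fun x => τ.toPreGNS (star (τ.ofPreGNS x))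
        map_add' := by intro x y; simp
        map_smul' := by intro c x; simp } 1 (by
          intro x
          rw [one_mul, PositiveLinearMap.preGNS_norm_def, PositiveLinearMap.preGNS_norm_def]
          simp [hτ.map_mul_comm (τ.ofPreGNS x)]))

theorem J_toL2 {τ : A →ₚ[ℂ] ℂ} (hτ : IsFaithfulTracialState τ) (x : A) :
    J hτ (toL2 τ x) = toL2 τ (star x) :=
  ContinuousLinearMap.completion_apply_coe _ (τ.toPreGNS x)

/-- The operator `J T J`. -/
noncomputable def conjJ {τ : A →ₚ[ℂ] ℂ} (hτ : IsFaithfulTracialState τ)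
    (T : τ.GNS →L[ℂ] τ.GNS) : τ.GNS →L[ℂ] τ.GNS :=
  ((J hτ).comp T).comp (J hτ)

/-- `J λ(A) J` is contained in `λ(A)'`. -/
theorem conjJ_mem_lamCommutant {τ : A →ₚ[ℂ] ℂ} (hτ : IsFaithfulTracialState τ)
    {T : τ.GNS →L[ℂ] τ.GNS} (hT : T ∈ lam τ) : conjJ hτ T ∈ lamCommutant τ := by
  obtain ⟨x, rfl⟩ := hT
  rintro _ ⟨y, rfl⟩
  refine ContinuousLinearMap.ext fun ξ => ?_
  refine congrFun ((denseRange_toL2 τ).equalizer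
    (g := ⇑(τ.gnsStarAlgHom y * conjJ hτ (τ.gnsStarAlgHom x)))
    (h := ⇑(conjJ hτ (τ.gnsStarAlgHom x) * τ.gnsStarAlgHom y))
    (ContinuousLinearMap.continuous _) (ContinuousLinearMap.continuous _) (funext fun b => ?_)) ξ
  simp [conjJ, J_toL2, gns_toL2, mul_assoc, -PositiveLinearMap.gnsStarAlgHom_apply]

/-- The map `β : λ(A) → λ(A)`, `β(λ(x)) = λ(α(x))`. -/
noncomputable def beta {τ : A →ₚ[ℂ] ℂ} (hτ : IsFaithfulTracialState τ)
    (α : InvolutiveStarAntiaut A) (T : lam τ) : lam τ :=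
  ⟨τ.gnsStarAlgHom (α ((StarAlgEquiv.ofInjective τ.gnsStarAlgHom (gns_injective hτ)).symm T)),
    _, rfl⟩

/-- The map `β' : λ(A)' → λ(A)'`, `β'(T) = J β(J T J) J`. It is defined once it is known that
`J λ(A)' J` is contained in `λ(A)`. -/
noncomputable def betaPrime {τ : A →ₚ[ℂ] ℂ} (hτ : IsFaithfulTracialState τ)
    (α : InvolutiveStarAntiaut A) (hJ : ∀ T ∈ lamCommutant τ, conjJ hτ T ∈ lam τ)
    (T : lamCommutant τ) : lamCommutant τ :=
  ⟨conjJ hτ (beta hτ α ⟨conjJ hτ T.1, hJ T.1 T.2⟩), conjJ_mem_lamCommutant hτ (beta hτ α _).2⟩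

/-- The real algebra `λ_r(A, α)' = {T ∈ λ(A)' : β'(T) = T*}`. -/
def realCommutant {τ : A →ₚ[ℂ] ℂ} (hτ : IsFaithfulTracialState τ)
    (α : InvolutiveStarAntiaut A) (hJ : ∀ T ∈ lamCommutant τ, conjJ hτ T ∈ lam τ) :
    Set (τ.GNS →L[ℂ] τ.GNS) :=
  {T | ∃ hT : T ∈ lamCommutant τ,
    (betaPrime hτ α hJ ⟨T, hT⟩ : τ.GNS →L[ℂ] τ.GNS) = star T}

/-- The real Hilbert space `L²(A, α)`: the completion of the real algebra `(A, α)`, realised as its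
closure in `L²(A)`. -/
noncomputable def realL2 (τ : A →ₚ[ℂ] ℂ) (α : InvolutiveStarAntiaut A) : Submodule ℝ τ.GNS :=
  (α.realForm.toSubalgebra.toSubmodule.map ((toL2 τ).restrictScalars ℝ)).topologicalClosure

theorem gns_mem_realL2 (τ : A →ₚ[ℂ] ℂ) (α : InvolutiveStarAntiaut A) (x : α.realForm)
    (ξ : τ.GNS) (hξ : ξ ∈ realL2 τ α) : τ.gnsStarAlgHom (x : A) ξ ∈ realL2 τ α := by
  refine map_mem_closure (τ.gnsStarAlgHom (x : A)).continuous hξ ?_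
  rintro _ ⟨y, hy, rfl⟩
  exact ⟨(x : A) * y, α.realForm.mul_mem x.2 hy, (gns_toL2 τ x y).symm⟩

/-- The canonical representation `λ_r` of `(A, α)` on the real Hilbert space `L²(A, α)`: `λ_r(x)`
is the extension of `y ↦ x y`, `y ∈ (A, α)`. -/
noncomputable def realRep (τ : A →ₚ[ℂ] ℂ) (α : InvolutiveStarAntiaut A) (x : α.realForm) :
    realL2 τ α →L[ℝ] realL2 τ α :=
  (((τ.gnsStarAlgHom (x : A)).restrictScalars ℝ).comp (realL2 τ α).subtypeL).codRestrict
    (realL2 τ α) (fun ξ => gns_mem_realL2 τ α x ξ.1 ξ.2)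

/-- The algebra `λ_r(A, α)`, as a set of operators on `L²(A)`: a bounded operator on the real
Hilbert space `L²(A, α)` is identified with its complex linear extension to the complexification
`L²(A) = L²(A, α) + i L²(A, α)`. -/
def realLam (τ : A →ₚ[ℂ] ℂ) (α : InvolutiveStarAntiaut A) : Set (τ.GNS →L[ℂ] τ.GNS) :=
  {T | ∃ x : α.realForm, ∀ ξ : realL2 τ α, T (ξ : τ.GNS) = (realRep τ α x ξ : τ.GNS)}

end CanonicalRep

/-! The core is the inclusion `Jλ(M)'J ⊆ λ(M)`. For selfadjoint `T ∈ λ(M)'`, the operator `S = JTJ`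
is left multiplication by the vector `ξ = T1`, and `Jξ = ξ`, so `ξ` is an `L²`-limit of selfadjoint
`yₙ ∈ M` with `yₙx → Sx` for every `x ∈ M`. The `yₙ` need not be bounded in norm, but the resolvents
`(yₙ + i)⁻¹` are contractions and converge strongly to `(S + i)⁻¹` (`tendsto_gns_inverse`).
Normality of `τ` puts this limit in `λ(M)` (`mem_lam_of_tendsto`), and inverting inside the
C⋆-algebra `λ(M)` gives `S ∈ λ(M)`. Hence every `T ∈ λ(M)'` is `Jλ(x)J`; then `β'(T) = Jλ(α(x))J`
and `T* = Jλ(x*)J`, and injectivity of `λ` reduces `β'(T) = T*` to `α(x) = x*`. -/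

open Filter Topology

/-! ### Weak limits and resolvents of operators on a Hilbert space. -/

section HilbertSpace

variable {H : Type*} [NormedAddCommGroup H] [InnerProductSpace ℂ H] [CompleteSpace H]

/-- A bounded family of operators converges weakly along every ultrafilter. -/
theorem exists_tendsto_inner_of_norm_le {ι : Type*} (U : Ultrafilter ι) (a : ι → H →L[ℂ] H)
    (C : ℝ) (ha : ∀ i, ‖a i‖ ≤ C) :
    ∃ b : H →L[ℂ] H, ∀ v w, Tendsto (fun i => ⟪a i v, w⟫_ℂ) U (𝓝 ⟪b v, w⟫_ℂ) := by
  have hbound : ∀ v w i, ‖⟪a i v, w⟫_ℂ‖ ≤ C * ‖v‖ * ‖w‖ := fun v w i =>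
    (norm_inner_le_norm _ _).trans <| by
      gcongr
      exact (a i).le_of_opNorm_le (ha i) v
  have hlim : ∀ v w, ∃ c ∈ Metric.closedBall (0 : ℂ) (C * ‖v‖ * ‖w‖),
      Tendsto (fun i => ⟪a i v, w⟫_ℂ) U (𝓝 c) := fun v w =>
    (isCompact_closedBall (0 : ℂ) _).ultrafilter_le_nhds (U.map fun i => ⟪a i v, w⟫_ℂ) <|
      le_principal_iff.mpr <| Filter.mem_map.mpr <| Filter.univ_mem' fun i => by
        simpa using hbound v w i
  choose L hL hLlim using hlim
  -- The limits form a bounded sesquilinear form, which Riesz representation turns into an operator.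
  let B : H →L⋆[ℂ] H →L[ℂ] ℂ := LinearMap.mkContinuous₂
    (LinearMap.mk₂'ₛₗ (starRingEnd ℂ) (RingHom.id ℂ) L
      (fun v v' w => tendsto_nhds_unique (hLlim (v + v') w) <| by
        simpa [inner_add_left] using (hLlim v w).add (hLlim v' w))
      (fun c v w => tendsto_nhds_unique (hLlim (c • v) w) <| by
        simpa [inner_smul_left, mul_comm] using (hLlim v w).const_mul (starRingEnd ℂ c))
      (fun v w w' => tendsto_nhds_unique (hLlim v (w + w')) <| by
        simpa [inner_add_right] using (hLlim v w).add (hLlim v w'))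
      (fun c v w => tendsto_nhds_unique (hLlim v (c • w)) <| by
        simpa [inner_smul_right] using (hLlim v w).const_mul c))
    C (fun v w => by simpa using hL v w)
  refine ⟨InnerProductSpace.continuousLinearMapOfBilin B, fun v w => ?_⟩
  rw [InnerProductSpace.continuousLinearMapOfBilin_apply]
  exact hLlim v w

/-- Since `⟪Tv, v⟫` is real, the cross term vanishes and `‖(T + i)v‖² = ‖Tv‖² + ‖v‖²`. -/
theorem IsSelfAdjoint.norm_le_norm_add_I_smul {T : H →L[ℂ] H} (hT : IsSelfAdjoint T) (v : H) :
    ‖v‖ ≤ ‖(T + Complex.I • 1) v‖ := by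
  have hsymm : ⟪T v, v⟫_ℂ = ⟪v, T v⟫_ℂ := by
    conv_lhs => rw [← hT.adjoint_eq]
    exact ContinuousLinearMap.adjoint_inner_left _ _ _
  have hre : (⟪T v, Complex.I • v⟫_ℂ).re = 0 := by
    have h : starRingEnd ℂ ⟪v, T v⟫_ℂ = ⟪v, T v⟫_ℂ := by rw [inner_conj_symm, hsymm]
    rw [inner_smul_right, hsymm, ← Complex.conj_eq_iff_real.mp h |>.choose_spec.symm]
    simp
  have h := norm_add_sq (𝕜 := ℂ) (T v) (Complex.I • v)
  rw [RCLike.re_to_complex, hre, norm_smul, Complex.norm_I] at h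
  have h' : (T + Complex.I • 1) v = T v + Complex.I • v := by simp
  rw [h']
  refine (pow_le_pow_iff_left₀ (norm_nonneg _) (norm_nonneg _) two_ne_zero).mp ?_
  nlinarith [sq_nonneg ‖T v‖]

theorem IsSelfAdjoint.isUnit_add_I_smul {A : Type*} [CStarAlgebra A] {a : A}
    (ha : IsSelfAdjoint a) : IsUnit (a + Complex.I • 1) := by
  have h : -Complex.I ∉ spectrum ℂ a := fun h => by
    simpa using congrArg Complex.im (ha.mem_spectrum_eq_re h)
  rw [spectrum.notMem_iff] at h
  have h' := h.neg
  rwa [Algebra.algebraMap_eq_smul_one, neg_smul, neg_sub, sub_neg_eq_add] at h'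

theorem IsSelfAdjoint.norm_inverse_add_I_smul_le {T R : H →L[ℂ] H} (hT : IsSelfAdjoint T)
    (hR : (T + Complex.I • 1) * R = 1) : ‖R‖ ≤ 1 := by
  refine R.opNorm_le_bound zero_le_one fun v => ?_
  have h := hT.norm_le_norm_add_I_smul (R v)
  have h' : (T + Complex.I • 1) (R v) = v := congrArg (fun f => f v) hR
  rwa [h', ← one_mul ‖v‖] at h

namespace VonNeumannAlgebra

/-- A von Neumann algebra is weakly closed. -/
theorem mem_of_tendsto_inner (M : VonNeumannAlgebra H) {ι : Type*} {l : Filter ι} [l.NeBot]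
    {a : ι → H →L[ℂ] H} (ha : ∀ i, a i ∈ M) {b : H →L[ℂ] H}
    (hb : ∀ v w, Tendsto (fun i => ⟪a i v, w⟫_ℂ) l (𝓝 ⟪b v, w⟫_ℂ)) : b ∈ M := by
  rw [← SetLike.mem_coe, ← M.centralizer_centralizer]
  intro y hy
  refine ContinuousLinearMap.ext fun v => ext_inner_right ℂ fun w => ?_
  refine tendsto_nhds_unique (f := fun i => ⟪a i v, ContinuousLinearMap.adjoint y w⟫_ℂ) (l := l)
    ?_ ?_
  · simpa [ContinuousLinearMap.adjoint_inner_right] using hb v (ContinuousLinearMap.adjoint y w)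
  · refine (hb (y v) w).congr fun i => ?_
    rw [ContinuousLinearMap.adjoint_inner_right]
    exact congrArg (fun f : H →L[ℂ] H => ⟪f v, w⟫_ℂ) (hy (a i) (ha i))

/-- A normal functional is weakly continuous on bounded sets. -/
theorem IsNormalFunctional.tendsto {M : VonNeumannAlgebra H} {φ : M → ℂ}
    (hφ : M.IsNormalFunctional φ) {ι : Type*} {l : Filter ι} {a : ι → M} {b : M} {C : ℝ}
    (ha : ∀ i, ‖a i‖ ≤ C)
    (hb : ∀ v w, Tendsto (fun i => ⟪(a i : H →L[ℂ] H) v, w⟫_ℂ) l (𝓝 ⟪(b : H →L[ℂ] H) v, w⟫_ℂ)) :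
    Tendsto (fun i => φ (a i)) l (𝓝 (φ b)) := by
  obtain ⟨ξ, η, hξ, hη, hsum⟩ := hφ
  simp_rw [← fun x => (hsum x).tsum_eq]
  refine tendsto_tsum_of_dominated_convergence (bound := fun n => C * (‖ξ n‖ ^ 2 + ‖η n‖ ^ 2))
    ((hξ.add hη).mul_left C) (fun n => ?_) (Eventually.of_forall fun i n => ?_)
  · have h := (Complex.continuous_conj.tendsto _).comp (hb (η n) (ξ n))
    simpa [Function.comp_def] using h
  · have hC : 0 ≤ C := (norm_nonneg _).trans (ha i)
    calc ‖⟪ξ n, (a i : H →L[ℂ] H) (η n)⟫_ℂ‖ ≤ ‖ξ n‖ * (C * ‖η n‖) :=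
          (norm_inner_le_norm _ _).trans <| by
            gcongr
            exact (a i : H →L[ℂ] H).le_of_opNorm_le (ha i) _
      _ = C * (‖ξ n‖ * ‖η n‖) := by ring
      _ ≤ C * (‖ξ n‖ ^ 2 + ‖η n‖ ^ 2) := by
          gcongr
          nlinarith [sq_nonneg (‖ξ n‖ - ‖η n‖), sq_nonneg ‖ξ n‖, sq_nonneg ‖η n‖]

end VonNeumannAlgebra

end HilbertSpace

/-! ### The antiunitary involution `J`. -/

namespace CanonicalRep

section CStarAlgebra

variable {A : Type*} [CStarAlgebra A] [PartialOrder A] [StarOrderedRing A] {τ : A →ₚ[ℂ] ℂ}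

theorem inner_toL2 (x y : A) : ⟪toL2 τ x, toL2 τ y⟫_ℂ = τ (star x * y) :=
  (UniformSpace.Completion.inner_coe _ _).trans (τ.preGNS_inner_def _ _)

theorem J_J (hτ : IsFaithfulTracialState τ) (ξ : τ.GNS) :
    J hτ (J hτ ξ) = ξ := by
  refine congrFun ((denseRange_toL2 τ).equalizer (g := fun ξ => J hτ (J hτ ξ)) (h := id)
    (by fun_prop) continuous_id (funext fun x => ?_)) ξ
  simp [J_toL2]

theorem inner_J_J (hτ : IsFaithfulTracialState τ) (ξ η : τ.GNS) :
    ⟪J hτ ξ, J hτ η⟫_ℂ = ⟪η, ξ⟫_ℂ := by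
  refine (denseRange_toL2 τ).induction_on₂
    (p := fun ξ η => ⟪J hτ ξ, J hτ η⟫_ℂ = ⟪η, ξ⟫_ℂ)
    (isClosed_eq (by fun_prop) (by fun_prop)) (fun x y => ?_) ξ η
  rw [J_toL2, J_toL2, inner_toL2, inner_toL2, star_star, hτ.map_mul_comm]

end CStarAlgebra

end CanonicalRep

/-! ### The commutant of `λ(A)`, resolvent convergence and the real form. -/

namespace CanonicalRep

section CStarAlgebra

variable {A : Type*} [CStarAlgebra A] [PartialOrder A] [StarOrderedRing A] {τ : A →ₚ[ℂ] ℂ}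

theorem conjJ_apply (hτ : IsFaithfulTracialState τ) (T : τ.GNS →L[ℂ] τ.GNS) (ξ : τ.GNS) :
    conjJ hτ T ξ = J hτ (T (J hτ ξ)) := rfl

theorem conjJ_conjJ (hτ : IsFaithfulTracialState τ) (T : τ.GNS →L[ℂ] τ.GNS) :
    conjJ hτ (conjJ hτ T) = T := by
  ext ξ
  simp [conjJ_apply, J_J]

theorem conjJ_star (hτ : IsFaithfulTracialState τ) (T : τ.GNS →L[ℂ] τ.GNS) :
    conjJ hτ (star T) = star (conjJ hτ T) := by
  refine (ContinuousLinearMap.eq_adjoint_iff _ _).mpr fun ξ η => ?_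
  rw [conjJ_apply, conjJ_apply, ← J_J hτ η, inner_J_J, J_J, ← J_J hτ ξ, inner_J_J, J_J]
  exact ContinuousLinearMap.adjoint_inner_right _ _ _

theorem star_mem_lamCommutant {T : τ.GNS →L[ℂ] τ.GNS} (hT : T ∈ lamCommutant τ) :
    star T ∈ lamCommutant τ := by
  intro y hy
  have h := congrArg star (hT (star y) (star_mem hy))
  simpa using h.symm

theorem lamCommutant_apply_toL2 {T : τ.GNS →L[ℂ] τ.GNS} (hT : T ∈ lamCommutant τ) (x : A) :
    T (toL2 τ x) = τ.gnsStarAlgHom x (T (toL2 τ 1)) := by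
  have h : τ.gnsStarAlgHom x * T = T * τ.gnsStarAlgHom x := hT _ ⟨x, rfl⟩
  rw [← mul_apply_eq_comp, h, mul_apply_eq_comp, gns_toL2, mul_one]

/-- Pair with `x ∈ A` and move `λ(x)` across the inner product. For selfadjoint `T` this makes `T1`
a fixed vector of `J`. -/
theorem J_lamCommutant_apply_one (hτ : IsFaithfulTracialState τ) {T : τ.GNS →L[ℂ] τ.GNS}
    (hT : T ∈ lamCommutant τ) : J hτ (T (toL2 τ 1)) = star T (toL2 τ 1) := by
  refine (denseRange_toL2 τ).eq_of_inner_left ℂ fun x => ?_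
  rw [ContinuousLinearMap.star_eq_adjoint, ContinuousLinearMap.adjoint_inner_left,
    lamCommutant_apply_toL2 hT x, ← ContinuousLinearMap.adjoint_inner_left,
    ← ContinuousLinearMap.star_eq_adjoint, ← map_star, gns_toL2, mul_one, ← J_toL2 hτ, ← inner_J_J hτ,
    J_J]

theorem isClosed_lam (hτ : IsFaithfulTracialState τ) :
    IsClosed (lam τ : Set (τ.GNS →L[ℂ] τ.GNS)) :=
  (NonUnitalStarAlgHom.isometry τ.gnsStarAlgHom (gns_injective hτ)).isClosedEmbedding.isClosed_range

/-- As `J` fixes `ξ`, averaging an approximating sequence with its adjoints keeps the limit. -/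
theorem exists_isSelfAdjoint_tendsto_toL2 (hτ : IsFaithfulTracialState τ) {ξ : τ.GNS}
    (hξ : J hτ ξ = ξ) :
    ∃ y : ℕ → A, (∀ n, IsSelfAdjoint (y n)) ∧
      Tendsto (fun n => toL2 τ (y n)) atTop (𝓝 ξ) := by
  obtain ⟨z, hz, hlim⟩ := mem_closure_iff_seq_limit.mp ((denseRange_toL2 τ) ξ)
  choose w hw using hz
  refine ⟨fun n => (2⁻¹ : ℝ) • (w n + star (w n)), fun n =>
    (IsSelfAdjoint.all (2⁻¹ : ℝ)).smul (IsSelfAdjoint.add_star_self (w n)), ?_⟩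
  have h := (hlim.add (((J hτ).continuous.tendsto ξ).comp hlim)).const_smul (2⁻¹ : ℂ)
  rw [hξ, ← two_smul ℂ ξ, smul_smul, inv_mul_cancel₀ two_ne_zero, one_smul] at h
  refine h.congr fun n => ?_
  rw [Function.comp_apply, ← hw n, J_toL2, ← map_add, ← map_smul]
  change _ = toL2 τ ((2⁻¹ : ℝ) • (w n + star (w n)))
  rw [← Complex.coe_smul]
  simp

/-- The resolvents of selfadjoint operators converge strongly if the operators do so on a dense
subspace. -/
theorem tendsto_gns_inverse {S R : τ.GNS →L[ℂ] τ.GNS}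
    (hSR : (S + Complex.I • 1) * R = 1) (hRS : R * (S + Complex.I • 1) = 1)
    {y r : ℕ → A} (hr : ∀ n, ‖r n‖ ≤ 1) (hry : ∀ n, r n * (y n + Complex.I • 1) = 1)
    (hy : ∀ x, Tendsto (fun n => toL2 τ (y n * x)) atTop (𝓝 (S (toL2 τ x)))) (ξ : τ.GNS) :
    Tendsto (fun n => τ.gnsStarAlgHom (r n) ξ) atTop (𝓝 (R ξ)) := by
  have hr' : ∀ n, ‖τ.gnsStarAlgHom (r n)‖ ≤ 1 := fun n =>
    (NonUnitalStarAlgHom.norm_apply_le τ.gnsStarAlgHom (r n)).trans (hr n)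
  have hR : Function.Surjective (S + Complex.I • (1 : τ.GNS →L[ℂ] τ.GNS)) := fun ξ =>
    ⟨R ξ, congrArg (fun f => f ξ) hSR⟩
  have hdense : DenseRange fun x => (S + Complex.I • (1 : τ.GNS →L[ℂ] τ.GNS)) (toL2 τ x) :=
    hR.denseRange.comp (denseRange_toL2 τ) (ContinuousLinearMap.continuous _)
  -- Because `rₙ(yₙ + i) = 1`, the error is `rₙ(Sx - yₙx)`, and `rₙ` is a contraction.
  have key : ∀ x, Tendsto (fun n => τ.gnsStarAlgHom (r n)
      ((S + Complex.I • (1 : τ.GNS →L[ℂ] τ.GNS)) (toL2 τ x))) atTop (𝓝 (toL2 τ x)) := by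
    intro x
    rw [tendsto_iff_norm_sub_tendsto_zero]
    refine squeeze_zero (fun _ => norm_nonneg _) (fun n => ?_)
      (tendsto_iff_norm_sub_tendsto_zero.mp (hy x))
    have h : toL2 τ x = τ.gnsStarAlgHom (r n) (toL2 τ ((y n + Complex.I • 1) * x)) := by
      rw [gns_toL2, ← mul_assoc, hry, one_mul]
    have h' : (S + Complex.I • (1 : τ.GNS →L[ℂ] τ.GNS)) (toL2 τ x) -
        toL2 τ ((y n + Complex.I • 1) * x) = S (toL2 τ x) - toL2 τ (y n * x) := by
      simp [add_mul]
    calc ‖τ.gnsStarAlgHom (r n) ((S + Complex.I • (1 : τ.GNS →L[ℂ] τ.GNS)) (toL2 τ x)) - toL2 τ x‖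
        = ‖τ.gnsStarAlgHom (r n) (S (toL2 τ x) - toL2 τ (y n * x))‖ := by
          rw [← h', map_sub (τ.gnsStarAlgHom (r n)), ← h]
      _ ≤ 1 * ‖S (toL2 τ x) - toL2 τ (y n * x)‖ :=
          (τ.gnsStarAlgHom (r n)).le_of_opNorm_le (hr' n) _
      _ = ‖toL2 τ (y n * x) - S (toL2 τ x)‖ := by rw [one_mul, norm_sub_rev]
  rw [Metric.tendsto_atTop]
  intro ε hε
  -- Replacing `ξ` by `ζ` costs at most `‖ξ - ζ‖` under `rₙ` and `‖R‖ ‖ξ - ζ‖` under `R`, together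
  -- below `ε / 3`.
  obtain ⟨x, hx⟩ := hdense.exists_dist_lt ξ (ε := ε / 3 / (1 + ‖R‖)) (by positivity)
  set ζ := (S + Complex.I • (1 : τ.GNS →L[ℂ] τ.GNS)) (toL2 τ x) with hζ
  have hRζ : R ζ = toL2 τ x := congrArg (fun f => f (toL2 τ x)) hRS
  obtain ⟨N, hN⟩ := Metric.tendsto_atTop.mp (key x) (ε / 3) (by positivity)
  rw [dist_eq_norm, lt_div_iff₀ (by positivity)] at hx
  refine ⟨N, fun n hn => ?_⟩
  have h1 := hN n hn
  rw [← hζ, ← hRζ, dist_eq_norm] at h1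
  have h2 : ‖τ.gnsStarAlgHom (r n) (ξ - ζ)‖ ≤ 1 * ‖ξ - ζ‖ :=
    (τ.gnsStarAlgHom (r n)).le_of_opNorm_le (hr' n) _
  have h3 : ‖R (ξ - ζ)‖ ≤ ‖R‖ * ‖ξ - ζ‖ := R.le_opNorm _
  have h4 : τ.gnsStarAlgHom (r n) ξ - R ξ = τ.gnsStarAlgHom (r n) (ξ - ζ) +
      (τ.gnsStarAlgHom (r n) ζ - R ζ) - R (ξ - ζ) := by
    rw [map_sub, map_sub]
    abel
  rw [dist_eq_norm, h4]
  have h5 := norm_sub_le (τ.gnsStarAlgHom (r n) (ξ - ζ) + (τ.gnsStarAlgHom (r n) ζ - R ζ))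
    (R (ξ - ζ))
  have h6 := norm_add_le (τ.gnsStarAlgHom (r n) (ξ - ζ)) (τ.gnsStarAlgHom (r n) ζ - R ζ)
  nlinarith [norm_nonneg (ξ - ζ), norm_nonneg R]

/-- Spectral permanence: the inverse of `R` lies in the closed ⋆-subalgebra `λ(A)`. -/
theorem mem_lam_of_inverse_mem (hτ : IsFaithfulTracialState τ) {S R : τ.GNS →L[ℂ] τ.GNS}
    (hSR : (S + Complex.I • 1) * R = 1) (hRS : R * (S + Complex.I • 1) = 1)
    (hR : R ∈ lam τ) : S ∈ lam τ := by
  have := isClosed_lam hτ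
  have hu : IsUnit R := ⟨⟨R, S + Complex.I • 1, hRS, hSR⟩, rfl⟩
  obtain ⟨u, hu'⟩ := (StarSubalgebra.coe_isUnit (S := lam τ) (a := ⟨R, hR⟩)).mp hu
  have h : S + Complex.I • 1 = ((u⁻¹ : (lam τ)ˣ) : lam τ) := by
    refine left_inv_eq_right_inv hSR ?_
    have h' : (u : lam τ) * ((u⁻¹ : (lam τ)ˣ) : lam τ) = 1 := u.mul_inv
    rw [hu'] at h'
    exact congrArg Subtype.val h'
  have hmem : S + Complex.I • 1 ∈ lam τ := h ▸ Subtype.property _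
  have h1 := sub_mem hmem ((lam τ).smul_mem (one_mem (lam τ)) Complex.I)
  rwa [add_sub_cancel_right] at h1

/-- An operator on `L²(A)` which agrees with `λ(x)` on `L²(A, α)` is `λ(x)`. -/
theorem mem_realLam_iff (α : InvolutiveStarAntiaut A) {T : τ.GNS →L[ℂ] τ.GNS} :
    T ∈ realLam τ α ↔ ∃ x ∈ α.realForm, T = τ.gnsStarAlgHom x := by
  constructor
  · rintro ⟨x, hx⟩
    refine ⟨x, x.2, ContinuousLinearMap.ext fun ξ => ?_⟩
    refine congrFun ((denseRange_toL2 τ).equalizer T.continuous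
      (τ.gnsStarAlgHom (x : A)).continuous (funext fun z => ?_)) ξ
    have hreal : ∀ y ∈ α.realForm, T (toL2 τ y) = τ.gnsStarAlgHom (x : A) (toL2 τ y) :=
      fun y hy => hx ⟨toL2 τ y, subset_closure ⟨y, hy, rfl⟩⟩
    have hadd : ∀ v w, α (v + w) = α v + α w := fun v w => map_add α.toLinearMap v w
    have hsmul : ∀ (c : ℂ) v, α (c • v) = c • α v := fun c v => map_smul α.toLinearMap c v
    -- Real and imaginary parts for the conjugate linear involution `z ↦ α(z)*`, whose fixed points
    -- are `(A, α)`.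
    have hz : z = ((2⁻¹ : ℂ) • (z + star (α z))) +
        Complex.I • ((2⁻¹ : ℂ) • (-Complex.I) • (z + (-1 : ℂ) • star (α z))) := by
      have hI : Complex.I * (2⁻¹ * -Complex.I) = 2⁻¹ := by
        rw [mul_left_comm, mul_neg, Complex.I_mul_I, neg_neg, mul_one]
      rw [smul_smul, smul_smul, mul_assoc, hI]
      module
    have h1 : (2⁻¹ : ℂ) • (z + star (α z)) ∈ α.realForm := by
      change α _ = star _
      rw [hsmul, hadd, α.map_star', α.involutive']
      simp [add_comm]
    have h2 : (2⁻¹ : ℂ) • (-Complex.I) • (z + (-1 : ℂ) • star (α z)) ∈ α.realForm := by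
      change α _ = star _
      rw [hsmul, hsmul, hadd, hsmul, α.map_star', α.involutive']
      simp [add_comm]
    rw [Function.comp_apply, Function.comp_apply, hz]
    simp only [map_add, map_smul (toL2 τ) Complex.I, map_smul T Complex.I,
      map_smul (τ.gnsStarAlgHom (x : A)) Complex.I, hreal _ h1, hreal _ h2]
  · rintro ⟨x, hx, rfl⟩
    exact ⟨⟨x, hx⟩, fun ξ => rfl⟩

theorem beta_gns (hτ : IsFaithfulTracialState τ) (α : InvolutiveStarAntiaut A) (x : A)
    (hx : τ.gnsStarAlgHom x ∈ lam τ) :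
    (beta hτ α ⟨τ.gnsStarAlgHom x, hx⟩ : τ.GNS →L[ℂ] τ.GNS) = τ.gnsStarAlgHom (α x) := by
  have h : (StarAlgEquiv.ofInjective τ.gnsStarAlgHom (gns_injective hτ)).symm
      ⟨τ.gnsStarAlgHom x, hx⟩ = x := by
    rw [StarAlgEquiv.symm_apply_eq]
    rfl
  exact congrArg (fun z => τ.gnsStarAlgHom (α z)) h

theorem realCommutant_eq (hτ : IsFaithfulTracialState τ) (α : InvolutiveStarAntiaut A)
    (hJ : ∀ T ∈ lamCommutant τ, conjJ hτ T ∈ lam τ) :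
    realCommutant hτ α hJ = conjJ hτ '' realLam τ α := by
  have key : ∀ (x : A) (T : τ.GNS →L[ℂ] τ.GNS) (hT : T ∈ lamCommutant τ),
      conjJ hτ T = τ.gnsStarAlgHom x →
      ((betaPrime hτ α hJ ⟨T, hT⟩ : τ.GNS →L[ℂ] τ.GNS) = star T ↔ α x = star x) := by
    intro x T hT hx
    have h : (betaPrime hτ α hJ ⟨T, hT⟩ : τ.GNS →L[ℂ] τ.GNS) =
        conjJ hτ (τ.gnsStarAlgHom (α x)) := by
      change conjJ hτ (beta hτ α ⟨conjJ hτ T, hJ T hT⟩ : τ.GNS →L[ℂ] τ.GNS) = _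
      rw [← beta_gns hτ α x ⟨x, rfl⟩]
      congr 3
      exact Subtype.ext hx
    have h' : star T = conjJ hτ (τ.gnsStarAlgHom (star x)) := by
      rw [map_star, ← hx, conjJ_star, conjJ_conjJ]
    rw [h, h', (Function.LeftInverse.injective (conjJ_conjJ hτ)).eq_iff,
      (gns_injective hτ).eq_iff]
  ext T
  constructor
  · rintro ⟨hT, h⟩
    obtain ⟨x, hx⟩ := hJ T hT
    exact ⟨conjJ hτ T, (mem_realLam_iff α).mpr ⟨x, (key x T hT hx.symm).mp h, hx.symm⟩,
      conjJ_conjJ hτ T⟩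
  · rintro ⟨S, hS, rfl⟩
    obtain ⟨x, hx, rfl⟩ := (mem_realLam_iff α).mp hS
    have hT := conjJ_mem_lamCommutant hτ (T := τ.gnsStarAlgHom x) ⟨x, rfl⟩
    exact ⟨hT, (key x _ hT (conjJ_conjJ hτ _)).mpr hx⟩

end CStarAlgebra

/-! ### Normality of `τ` and the inclusion `Jλ(M)'J ⊆ λ(M)`. -/

section VonNeumannAlgebra

variable {H : Type*} [NormedAddCommGroup H] [InnerProductSpace ℂ H] [CompleteSpace H]
  {M : VonNeumannAlgebra H} {τ : M →ₚ[ℂ] ℂ}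

/-- Bounded strong limits of sequences in `λ(M)` are in `λ(M)` if `τ` is normal. -/
theorem mem_lam_of_tendsto (hnormal : M.IsNormalFunctional τ) {r : ℕ → M} {C : ℝ}
    (hr : ∀ n, ‖r n‖ ≤ C) {R : τ.GNS →L[ℂ] τ.GNS}
    (hR : ∀ ξ, Tendsto (fun n => τ.gnsStarAlgHom (r n) ξ) atTop (𝓝 (R ξ))) : R ∈ lam τ := by
  -- The weak limit is taken on `H`, where `M` is weakly closed; normality carries it to `L²(M)`
  -- through the coefficients `τ(y* rₙ z)`.
  let U : Ultrafilter ℕ := hyperfilter ℕ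
  obtain ⟨b, hb⟩ := exists_tendsto_inner_of_norm_le U (fun n => (r n : H →L[ℂ] H)) C hr
  let s : M := ⟨b, M.mem_of_tendsto_inner (fun n => (r n).2) hb⟩
  refine ⟨s, ContinuousLinearMap.ext fun ξ => ?_⟩
  refine congrFun ((denseRange_toL2 τ).equalizer (τ.gnsStarAlgHom s).continuous R.continuous
    (funext fun z => ?_)) ξ
  refine (denseRange_toL2 τ).eq_of_inner_right ℂ fun y => ?_
  have h1 : Tendsto (fun n => ⟪toL2 τ y, τ.gnsStarAlgHom (r n) (toL2 τ z)⟫_ℂ) U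
      (𝓝 ⟪toL2 τ y, R (toL2 τ z)⟫_ℂ) :=
    tendsto_const_nhds.inner ((hR (toL2 τ z)).mono_left Nat.hyperfilter_le_atTop)
  have h2 : Tendsto (fun n => τ (star y * (r n * z))) U (𝓝 (τ (star y * (s * z)))) := by
    refine hnormal.tendsto (C := ‖star y‖ * (C * ‖z‖)) (fun n => ?_) (fun v w => ?_)
    · refine (norm_mul_le _ _).trans ?_
      gcongr
      refine (norm_mul_le _ _).trans ?_
      gcongr
      exact hr n
    · have h := hb ((z : H →L[ℂ] H) v) ((y : H →L[ℂ] H) w)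
      simp_rw [← ContinuousLinearMap.adjoint_inner_left] at h
      exact h
  refine tendsto_nhds_unique (f := fun n => τ (star y * (r n * z))) (l := U) ?_ ?_
  · rw [Function.comp_apply, gns_toL2, inner_toL2]
    exact h2
  · refine h1.congr fun n => ?_
    rw [gns_toL2, inner_toL2]

theorem conjJ_mem_lam_of_isSelfAdjoint (hτ : IsFaithfulTracialState τ)
    (hnormal : M.IsNormalFunctional τ) {T : τ.GNS →L[ℂ] τ.GNS} (hT : T ∈ lamCommutant τ)
    (hsa : IsSelfAdjoint T) : conjJ hτ T ∈ lam τ := by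
  have hS : IsSelfAdjoint (conjJ hτ T) := by rw [IsSelfAdjoint, ← conjJ_star, hsa.star_eq]
  obtain ⟨u, hu⟩ := hS.isUnit_add_I_smul
  obtain ⟨y, hysa, hy⟩ := exists_isSelfAdjoint_tendsto_toL2 hτ (ξ := T (toL2 τ 1))
    (by rw [J_lamCommutant_apply_one hτ hT, hsa.star_eq])
  choose v hv using fun n => (hysa n).isUnit_add_I_smul
  have hr : ∀ n, ‖((v n)⁻¹ : Mˣ).val‖ ≤ 1 := fun n => by
    have hsa' : IsSelfAdjoint (y n : H →L[ℂ] H) := congrArg Subtype.val (hysa n)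
    refine hsa'.norm_inverse_add_I_smul_le ?_
    have h := (v n).mul_inv
    rw [hv] at h
    exact congrArg Subtype.val h
  have hSR : (conjJ hτ T + Complex.I • 1) * (u⁻¹).val = 1 := by rw [← hu, u.mul_inv]
  have hRS : (u⁻¹).val * (conjJ hτ T + Complex.I • 1) = 1 := by rw [← hu, u.inv_mul]
  refine mem_lam_of_inverse_mem hτ hSR hRS (mem_lam_of_tendsto hnormal hr fun ξ =>
    tendsto_gns_inverse hSR hRS hr (fun n => by rw [← hv, (v n).inv_mul]) (fun x => ?_) ξ)
  -- `Sx = Jλ(x*)T1` is the limit of `J(x* yₙ) = yₙx`.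
  rw [conjJ_apply, J_toL2, lamCommutant_apply_toL2 hT]
  refine ((((J hτ).continuous.comp (τ.gnsStarAlgHom (star x)).continuous).tendsto _).comp hy).congr
    fun n => ?_
  change J hτ (τ.gnsStarAlgHom (star x) (toL2 τ (y n))) = _
  rw [gns_toL2, J_toL2, star_mul, star_star, (hysa n).star_eq]

/-- `J λ(M)' J` is contained in `λ(M)`. -/
theorem conjJ_mem_lam (hτ : IsFaithfulTracialState τ) (hnormal : M.IsNormalFunctional τ)
    {T : τ.GNS →L[ℂ] τ.GNS} (hT : T ∈ lamCommutant τ) : conjJ hτ T ∈ lam τ := by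
  have hadd : T + star T ∈ lamCommutant τ := Set.add_mem_centralizer hT (star_mem_lamCommutant hT)
  have hsmul : Complex.I • (T - star T) ∈ lamCommutant τ := fun y hy => by
    have h := hT y hy
    have h' := star_mem_lamCommutant hT y hy
    rw [mul_smul_comm, smul_mul_assoc, mul_sub, sub_mul, h, h']
  have h1 := conjJ_mem_lam_of_isSelfAdjoint hτ hnormal hadd (IsSelfAdjoint.add_star_self T)
  have h2 := conjJ_mem_lam_of_isSelfAdjoint hτ hnormal hsmul (by
    simp [IsSelfAdjoint, star_smul, ← smul_neg])
  -- `T ↦ JTJ` is conjugate linear, so the coefficient is `i` where recovering `T` itself would need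
  -- `-i`.
  have h : conjJ hτ T = (2⁻¹ : ℂ) • (conjJ hτ (T + star T) +
      Complex.I • conjJ hτ (Complex.I • (T - star T))) := by
    ext ξ
    simp only [conjJ_apply, add_apply, smul_apply,
      sub_apply, map_add, map_sub, map_smulₛₗ, Complex.conj_I, smul_smul]
    simp only [mul_neg, Complex.I_mul_I, neg_neg, one_smul]
    module
  rw [h]
  exact (lam τ).smul_mem (add_mem h1 ((lam τ).smul_mem h2 _)) _

end VonNeumannAlgebra

end CanonicalRep

theorem mainTheorem8 {H : Type*} [NormedAddCommGroup H] [InnerProductSpace ℂ H] [CompleteSpace H]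
    (M : VonNeumannAlgebra H) (hfactor : M.IsFactor) (hfinite : M.IsFinite)
    (τ : M →ₚ[ℂ] ℂ) (hτ : IsFaithfulTracialState τ) (hnormal : M.IsNormalFunctional τ)
    (α : InvolutiveStarAntiaut M) :
    ∃ hJ : ∀ T ∈ CanonicalRep.lamCommutant τ, CanonicalRep.conjJ hτ T ∈ CanonicalRep.lam τ,
      CanonicalRep.realCommutant hτ α hJ =
        CanonicalRep.conjJ hτ '' CanonicalRep.realLam τ α :=
  ⟨fun _ hT => CanonicalRep.conjJ_mem_lam hτ hnormal hT,
    CanonicalRep.realCommutant_eq hτ α _⟩
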